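/- There is an absolute constant $C>0$ such that the following holds. Let $n,N$ be integers with $1<n\le N$, let $e_1,\dots,e_N$ be the standard basis of $l_2^N$ (that is, $\mathbb{R}^N$ with the Euclidean norm), and let $u$ be a linear operator on $l_2^N$ with operator norm $\|u\|=1$. Put $M=\max_{1\le j\le N}\|ue_j\|$. Let $\sigma$ be the random subset of $\{1,\dots,N\}$ that contains each element independently with probability $\delta=n/N$ (so the expected cardinality of $\sigma$ is $n$). Then $$\mathbb{E}\,\big\|u|_{\mathbb{R}^\sigma}\big\|\le C\sqrt{\log n}\,\Big(\sqrt{\frac nN}+\sqrt{\log n}\;M\Big),$$ where $\mathbb{R}^\sigma=\{x\in\mathbb{R}^N: x_j=0 \text{ for } j\notin\sigma\}$ and $\|u|_{\mathbb{R}^\sigma}\|$ is the operator norm of the restriction of $u$ to $\mathbb{R}^\sigma$. -/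

import Mathlib

open MeasureTheory ProbabilityTheory

/-- The coordinate subspace `ℝ^σ` of `l₂^N`: the vectors whose coordinates outside `σ` vanish. -/
def coordSubspace {N : ℕ} (σ : Set (Fin N)) : Submodule ℝ (EuclideanSpace ℝ (Fin N)) where
  carrier := {x | ∀ j, j ∉ σ → x j = 0}
  add_mem' {x y} hx hy j hj := by simp [hx j hj, hy j hj]
  zero_mem' j _ := by simp
  smul_mem' c x hx j hj := by simp [hx j hj]

/-- The restriction `u|_{ℝ^σ} : ℝ^σ → l₂^N` of a linear operator `u` on `l₂^N`; its norm is the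
operator norm with respect to the Euclidean norms. -/
noncomputable def coordRestrict {N : ℕ}
    (u : EuclideanSpace ℝ (Fin N) →L[ℝ] EuclideanSpace ℝ (Fin N)) (σ : Set (Fin N)) :
    coordSubspace σ →L[ℝ] EuclideanSpace ℝ (Fin N) :=
  u.comp (coordSubspace σ).subtypeL

/-! Put `x_j = u e_j` and `X_σ = ∑_{j ∈ σ} x_j ⊗ x_j`. Then `‖u|_{ℝ^σ}‖² ≤ ‖X_σ‖`, and high trace
moments of the positive operator `X_σ` control its norm. Expanding one factor of `tr X_σ^(q+1)` and
conditioning on `j ∈ σ` gives `δ ∑_j E⟨x_j, X_{σ ∪ {j}}^q x_j⟩`. Inserting `j` is a rank-one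
perturbation, whose cost is bounded pointwise: `⟨x, (Y + x ⊗ x)^q x⟩ ≤ 3⟨x, Y^q x⟩ + ‖x‖²
((q+1)‖x‖²)^q` (`inner_pow_add_rankOne_le`). It follows from a renewal identity and the
log-convexity of `⟨x, Y^k x⟩` in `k`. Since `∑_j x_j ⊗ x_j = u u* ≤ 1`, summing over `j` returns to
`tr X_σ^q`, so each power costs a factor `3δ` plus an error in `M²`. Iterating up to power `2s`
leaves the prefactor `δN = n`, whose `2s`-th root is bounded once `s ≥ log n`. -/

/-! ### Scalar inequalities: log-convex sequences and renewal recursions -/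

/-- A nonnegative log-convex sequence is dominated up to any index `q` by the geometric sequence
that interpolates its values at `0` and `q`. -/
lemma exists_geometric_majorant_of_logConvex {a : ℕ → ℝ} (h0 : 0 < a 0) (hnn : ∀ k, 0 ≤ a k)
    (hlc : ∀ k, a (k + 1) ^ 2 ≤ a k * a (k + 2)) (q : ℕ) :
    ∃ α : ℝ, 0 ≤ α ∧ a 0 * α ^ q = a q ∧ ∀ i ≤ q, a i ≤ a 0 * α ^ i := by
  rcases Nat.eq_zero_or_pos q with rfl | hq
  · exact ⟨0, le_rfl, by simp, fun i hi => by simp [Nat.le_zero.1 hi]⟩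
  set s : ℕ → ℝ := fun k => a k / a 0 with hs
  have hs0 : s 0 = 1 := div_self h0.ne'
  have hsnn : ∀ k, 0 ≤ s k := fun k => div_nonneg (hnn k) h0.le
  have hslc : ∀ k, s (k + 1) ^ 2 ≤ s k * s (k + 2) := fun k => by
    simp only [hs]
    rw [div_pow, div_mul_div_comm, ← sq]
    exact div_le_div_of_nonneg_right (hlc k) (by positivity)
  -- This says that `s k ^ (1/k)` is nondecreasing, written without roots.
  have hstep : ∀ k, s k ^ (k + 1) ≤ s (k + 1) ^ k := by
    intro k
    induction k with
    | zero => simp [hs0]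
    | succ k ih =>
      rcases (hsnn (k + 1)).eq_or_lt with h | h
      · rw [← h, zero_pow (by omega)]
        exact pow_nonneg (hsnn _) _
      · have h1 : s (k + 1) ^ k * s (k + 1) ^ (k + 2) ≤ s (k + 1) ^ k * s (k + 2) ^ (k + 1) := by
          calc s (k + 1) ^ k * s (k + 1) ^ (k + 2) = (s (k + 1) ^ 2) ^ (k + 1) := by ring
            _ ≤ (s k * s (k + 2)) ^ (k + 1) := pow_le_pow_left₀ (sq_nonneg _) (hslc k) _
            _ = s k ^ (k + 1) * s (k + 2) ^ (k + 1) := mul_pow _ _ _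
            _ ≤ s (k + 1) ^ k * s (k + 2) ^ (k + 1) :=
              mul_le_mul_of_nonneg_right ih (pow_nonneg (hsnn _) _)
        exact le_of_mul_le_mul_left h1 (pow_pos h k)
  set α : ℝ := s q ^ ((q : ℝ)⁻¹) with hα
  have hα0 : 0 ≤ α := Real.rpow_nonneg (hsnn q) _
  have hαq : α ^ q = s q := Real.rpow_inv_natCast_pow (hsnn q) hq.ne'
  have hbound : ∀ i ≤ q, s i ≤ α ^ i := by
    intro i hi
    induction hi using Nat.decreasingInduction with
    | self => exact hαq.ge
    | of_succ k _ ih =>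
      refine le_of_pow_le_pow_left₀ (Nat.succ_ne_zero k) (pow_nonneg hα0 _) ?_
      calc s k ^ (k + 1) ≤ s (k + 1) ^ k := hstep k
        _ ≤ (α ^ (k + 1)) ^ k := pow_le_pow_left₀ (hsnn _) ih _
        _ = (α ^ k) ^ (k + 1) := by rw [← pow_mul, ← pow_mul, mul_comm]
  refine ⟨α, hα0, ?_, fun i hi => ?_⟩
  · rw [hαq, hs]
    field_simp
  · have := mul_le_mul_of_nonneg_left (hbound i hi) h0.le
    rwa [hs, mul_div_cancel₀ _ h0.ne'] at this

/-- Solutions of the renewal recursion `b k = a k + ∑ a i * b (k - 1 - i)` driven by a sequence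
that is dominated by `m * α ^ i`. -/
lemma renewal_le_of_le_geometric {a b : ℕ → ℝ} {m α : ℝ} {q : ℕ} (hm : 0 ≤ m) (hα : 0 ≤ α)
    (hb : ∀ k, 0 ≤ b k)
    (hrec : ∀ k, b k = a k + ∑ i ∈ Finset.range k, a i * b (k - 1 - i))
    (ha : ∀ i ≤ q, a i ≤ m * α ^ i) : ∀ k ≤ q, b k ≤ m * (m + α) ^ k := by
  intro k
  induction k using Nat.strong_induction_on with
  | _ k ih =>
    intro hk
    have hsum : ∑ i ∈ Finset.range k, a i * b (k - 1 - i) ≤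
        ∑ i ∈ Finset.range k, m * m * (α ^ i * (m + α) ^ (k - 1 - i)) := by
      refine Finset.sum_le_sum fun i hi => ?_
      have hi' := Finset.mem_range.1 hi
      calc a i * b (k - 1 - i) ≤ (m * α ^ i) * (m * (m + α) ^ (k - 1 - i)) :=
            mul_le_mul (ha i (by omega)) (ih _ (by omega) (by omega)) (hb _) (by positivity)
        _ = _ := by ring
    -- This telescoping is what makes `m * (m + α) ^ k` an exact solution of the recursion driven by
    -- `m * α ^ i`.
    have hgeom : (∑ i ∈ Finset.range k, α ^ i * (m + α) ^ (k - 1 - i)) * m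
        = (m + α) ^ k - α ^ k := by
      have := (Commute.all α (m + α)).geom_sum₂_mul k
      linarith
    rw [hrec k]
    rw [← Finset.mul_sum] at hsum
    have := ha k hk
    nlinarith

/-- If `q * m ≤ α`, then `m + α ≤ (1 + 1/q) α` and `(1 + 1/q)^q ≤ e ≤ 3`; otherwise `α` is absorbed
into `(q + 1) * m`. The coefficient of `α ^ q` thus stays bounded in `q`, so that iteration costs
`3δ` per power. -/
lemma add_pow_le_three_mul_pow_add {m α : ℝ} (hm : 0 ≤ m) (hα : 0 ≤ α) (q : ℕ) :
    (m + α) ^ q ≤ 3 * α ^ q + ((q + 1) * m) ^ q := by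
  rcases Nat.eq_zero_or_pos q with rfl | hq
  · norm_num
  have hq' : (0 : ℝ) < q := by exact_mod_cast hq
  rcases le_total (q * m) α with h | h
  · have h1 : m + α ≤ (1 / q + 1) * α := by
      have : m ≤ α / q := by rw [le_div_iff₀ hq']; linarith
      calc m + α ≤ α / q + α := by linarith
        _ = _ := by ring
    have h2 : ((1 : ℝ) / q + 1) ^ q ≤ 3 := by
      calc ((1 : ℝ) / q + 1) ^ q ≤ Real.exp (1 / q) ^ q :=
            pow_le_pow_left₀ (by positivity) (Real.add_one_le_exp _) _
        _ = Real.exp 1 := by rw [← Real.exp_nat_mul]; congr 1; field_simp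
        _ ≤ 3 := by linarith [Real.exp_one_lt_d9]
    calc (m + α) ^ q ≤ ((1 / q + 1) * α) ^ q := pow_le_pow_left₀ (by positivity) h1 _
      _ = (1 / q + 1) ^ q * α ^ q := mul_pow _ _ _
      _ ≤ 3 * α ^ q := mul_le_mul_of_nonneg_right h2 (by positivity)
      _ ≤ _ := le_add_of_nonneg_right (by positivity)
  · calc (m + α) ^ q ≤ ((q + 1) * m) ^ q :=
          pow_le_pow_left₀ (by positivity) (by linarith) _
      _ ≤ _ := le_add_of_nonneg_left (by positivity)

/-! ### Rank-one perturbations of positive operators -/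

section Operators

variable {E : Type*} [NormedAddCommGroup E] [InnerProductSpace ℝ E]

open InnerProductSpace ContinuousLinearMap

/-- Each term of the sum records the leftmost occurrence of the rank-one factor, preceded by `Y ^
i`. -/
lemma pow_add_rankOne_apply (Y : E →L[ℝ] E) (x : E) (k : ℕ) :
    ((Y + rankOne ℝ x x) ^ k) x = (Y ^ k) x +
      ∑ i ∈ Finset.range k, inner ℝ x (((Y + rankOne ℝ x x) ^ (k - 1 - i)) x) • (Y ^ i) x := by
  induction k with
  | zero => simp
  | succ k ih =>
    have hsucc : ∀ (T : E →L[ℝ] E) (i : ℕ) (v : E), (T ^ (i + 1)) v = T ((T ^ i) v) :=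
      fun T i v => by rw [pow_succ']; rfl
    have hstep : ((Y + rankOne ℝ x x) ^ (k + 1)) x = Y (((Y + rankOne ℝ x x) ^ k) x) +
        inner ℝ x (((Y + rankOne ℝ x x) ^ k) x) • x := by rw [hsucc]; rfl
    rw [Finset.sum_range_succ', hstep]
    nth_rewrite 1 [ih]
    rw [map_add, map_sum, add_assoc, hsucc]
    congr 2
    · refine Finset.sum_congr rfl fun i _ => ?_
      rw [map_smul, hsucc, show k + 1 - 1 - (i + 1) = k - 1 - i by omega]

lemma inner_pow_add_rankOne (Y : E →L[ℝ] E) (x : E) (k : ℕ) :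
    inner ℝ x (((Y + rankOne ℝ x x) ^ k) x) = inner ℝ x ((Y ^ k) x) +
      ∑ i ∈ Finset.range k, inner ℝ x ((Y ^ i) x) *
        inner ℝ x (((Y + rankOne ℝ x x) ^ (k - 1 - i)) x) := by
  conv_lhs => rw [pow_add_rankOne_apply]
  rw [inner_add_right, inner_sum]
  simp only [inner_smul_right, mul_comm]

variable [FiniteDimensional ℝ E]

lemma ContinuousLinearMap.IsPositive.pow_isPositive {T : E →L[ℝ] E} (hT : T.IsPositive) (k : ℕ) :
    (T ^ k).IsPositive := by
  induction k using Nat.twoStepInduction with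
  | zero => exact isPositive_one
  | one => simpa using hT
  | more k ih _ =>
    have h := ih.conj_adjoint T
    rw [hT.isSelfAdjoint.adjoint_eq] at h
    have : T ^ (k + 2) = T ∘L (T ^ k) ∘L T := by
      rw [pow_succ, pow_succ']; rfl
    rwa [this]

lemma ContinuousLinearMap.IsPositive.inner_sq_le {T : E →L[ℝ] E} (hT : T.IsPositive) (x y : E) :
    inner ℝ x (T y) ^ 2 ≤ inner ℝ x (T x) * inner ℝ y (T y) := by
  obtain ⟨m, v, rfl⟩ := isPositive_iff_eq_sum_rankOne.1 hT
  have key : ∀ z w : E, inner ℝ z ((∑ i, rankOne ℝ (v i) (v i)) w)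
      = ∑ i, inner ℝ (v i) z * inner ℝ (v i) w := fun z w => by
    simp only [sum_apply, rankOne_apply, inner_sum, inner_smul_right]
    exact Finset.sum_congr rfl fun i _ => by rw [mul_comm, real_inner_comm]
  simp only [key, ← sq]
  exact Finset.sum_mul_sq_le_sq_mul_sq _ _ _

/-- Cauchy–Schwarz for the form `⟨·, T^k ·⟩` at `x` and `T x`. -/
lemma ContinuousLinearMap.IsPositive.inner_pow_logConvex {T : E →L[ℝ] E} (hT : T.IsPositive)
    (x : E) (k : ℕ) :
    inner ℝ x ((T ^ (k + 1)) x) ^ 2 ≤ inner ℝ x ((T ^ k) x) * inner ℝ x ((T ^ (k + 2)) x) := by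
  have h := (hT.pow_isPositive k).inner_sq_le x (T x)
  have h1 : (T ^ k) (T x) = (T ^ (k + 1)) x := by rw [pow_succ]; rfl
  have h2 : inner ℝ (T x) ((T ^ k) (T x)) = inner ℝ x ((T ^ (k + 2)) x) := by
    rw [hT.inner_left_eq_inner_right, h1, pow_succ' T (k + 1)]; rfl
  rwa [h2, h1] at h

lemma ContinuousLinearMap.IsPositive.inner_pow_le_inner_pow_add_rankOne {Y : E →L[ℝ] E}
    (hY : Y.IsPositive) (x : E) (q : ℕ) :
    inner ℝ x ((Y ^ q) x) ≤ inner ℝ x (((Y + rankOne ℝ x x) ^ q) x) := by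
  rw [inner_pow_add_rankOne]
  exact le_add_of_nonneg_right <| Finset.sum_nonneg fun i _ =>
    mul_nonneg ((hY.pow_isPositive _).inner_nonneg_right x)
      (((hY.add (isPositive_rankOne_self x)).pow_isPositive _).inner_nonneg_right x)

lemma ContinuousLinearMap.IsPositive.inner_pow_add_rankOne_le {Y : E →L[ℝ] E}
    (hY : Y.IsPositive) (x : E) (q : ℕ) :
    inner ℝ x (((Y + rankOne ℝ x x) ^ q) x) ≤
      3 * inner ℝ x ((Y ^ q) x) + ‖x‖ ^ 2 * ((q + 1) * ‖x‖ ^ 2) ^ q := by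
  rcases eq_or_ne x 0 with rfl | hx
  · simp
  have h0 : inner ℝ x ((Y ^ 0) x) = ‖x‖ ^ 2 := by simp
  obtain ⟨α, hα, hq, hle⟩ := exists_geometric_majorant_of_logConvex
    (a := fun k => inner ℝ x ((Y ^ k) x)) (by rw [h0]; positivity)
    (fun k => (hY.pow_isPositive k).inner_nonneg_right x) (hY.inner_pow_logConvex x) q
  simp only [h0] at hq hle
  have hb := renewal_le_of_le_geometric (sq_nonneg ‖x‖) hα
    (fun k => ((hY.add (isPositive_rankOne_self x)).pow_isPositive k).inner_nonneg_right x)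
    (inner_pow_add_rankOne Y x) hle q le_rfl
  have h3 := mul_le_mul_of_nonneg_left
    (add_pow_le_three_mul_pow_add (sq_nonneg ‖x‖) hα q) (sq_nonneg ‖x‖)
  rw [← hq]
  linarith

end Operators

/-! ### Conditioning for Bernoulli random sets -/

/-- Conditioning a Bernoulli random set on containing `j` amounts to inserting `j`. -/
lemma integral_indicator_mem_setBernoulli {ι : Type*} [Fintype ι] (δ : unitInterval) (j : ι)
    (F : Set ι → ℝ) :
    ∫ σ, {σ : Set ι | j ∈ σ}.indicator F σ ∂(setBernoulli (Set.univ : Set ι) δ) =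
      δ * ∫ σ, F (insert j σ) ∂(setBernoulli (Set.univ : Set ι) δ) := by
  classical
  set μ := setBernoulli (Set.univ : Set ι) δ
  have hsplit : ∀ G : Set ι → ℝ, ∑ σ, G σ =
      ∑ σ with j ∉ σ, (G σ + G (insert j σ)) := fun G => by
    rw [← Finset.sum_filter_not_add_sum_filter _ (fun σ : Set ι => j ∈ σ), Finset.sum_add_distrib]
    congr 1
    refine Finset.sum_nbij' (fun σ => σ \ {j}) (fun σ => insert j σ) ?_ ?_ ?_ ?_ ?_
    · simp
    · simp
    · intro σ hσ
      exact Set.insert_sdiff_self_of_mem (Finset.mem_filter.1 hσ).2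
    · intro σ hσ
      exact Set.insert_sdiff_self_of_notMem (Finset.mem_filter.1 hσ).2
    · intro σ hσ
      rw [Set.insert_sdiff_self_of_mem (Finset.mem_filter.1 hσ).2]
  -- Within each pair `σ`, `insert j σ`, the larger set carries the fraction `δ` of the mass.
  have hweight : ∀ σ : Set ι, j ∉ σ →
      μ.real {insert j σ} = δ * (μ.real {σ} + μ.real {insert j σ}) := fun σ hσ => by
    have h1 : (insert j σ).ncard = σ.ncard + 1 := Set.ncard_insert_of_notMem hσ
    have h2 : (Set.univ \ σ).ncard = (Set.univ \ insert j σ).ncard + 1 := by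
      rw [← Set.ncard_insert_of_notMem (a := j) (by simp)]
      congr 1
      ext i
      by_cases hi : i = j <;> simp [hi, hσ]
    rw [setBernoulli_real_singleton δ (Set.subset_univ _) Set.finite_univ,
      setBernoulli_real_singleton δ (Set.subset_univ _) Set.finite_univ, h1, h2]
    ring
  rw [integral_fintype .of_finite, integral_fintype .of_finite, hsplit, hsplit, Finset.mul_sum]
  refine Finset.sum_congr rfl fun σ hσ => ?_
  have hj := (Finset.mem_filter.1 hσ).2
  simp only [smul_eq_mul, Set.indicator, Set.mem_ofPred_eq, hj, Set.mem_insert_iff, true_or,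
    if_true, if_false, Set.insert_idem, mul_zero, zero_add]
  rw [← add_mul, ← mul_assoc, ← hweight σ hj]

/-! ### Trace moments of random sums of rank-one operators -/

section RandomSums

open InnerProductSpace ContinuousLinearMap

variable {E ι : Type*} [NormedAddCommGroup E] [InnerProductSpace ℝ E] [Fintype ι]

/-- The partial sum over `σ` of the rank-one operators `x_j ⊗ x_j`. -/
noncomputable def rankOneSum (x : ι → E) (σ : Set ι) : E →L[ℝ] E :=
  ∑ j, σ.indicator (fun j => rankOne ℝ (x j) (x j)) j

lemma isPositive_rankOneSum (x : ι → E) (σ : Set ι) : (rankOneSum x σ).IsPositive :=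
  isPositive_sum _ fun j _ => by
    by_cases hj : j ∈ σ
    · simp [hj]
    · simp [hj, isPositive_zero]

lemma rankOneSum_insert (x : ι → E) {σ : Set ι} {j : ι} (hj : j ∉ σ) :
    rankOneSum x (insert j σ) = rankOneSum x σ + rankOne ℝ (x j) (x j) := by
  classical
  have h : ∀ i, (insert j σ).indicator (fun j => rankOne ℝ (x j) (x j)) i =
      σ.indicator (fun j => rankOne ℝ (x j) (x j)) i +
        if i = j then rankOne ℝ (x j) (x j) else 0 := fun i => by
    by_cases hi : i = j
    · subst hi; simp [hj]
    · simp [hi, Set.indicator]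
  simp only [rankOneSum, h, Finset.sum_add_distrib, Finset.sum_ite_eq', Finset.mem_univ, if_true]

variable [FiniteDimensional ℝ E]

/-- As `j` may already lie in `σ`, the perturbation bound is applied over `σ \ {j}`; monotonicity
under adding `x_j ⊗ x_j` then restores `σ`. -/
lemma inner_pow_rankOneSum_insert_le (x : ι → E) (σ : Set ι) (j : ι) (q : ℕ) :
    inner ℝ (x j) ((rankOneSum x (insert j σ) ^ q) (x j)) ≤
      3 * inner ℝ (x j) ((rankOneSum x σ ^ q) (x j)) +
        ‖x j‖ ^ 2 * ((q + 1) * ‖x j‖ ^ 2) ^ q := by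
  have hdiff : j ∉ σ \ {j} := by simp
  have hpos := isPositive_rankOneSum x (σ \ {j})
  have hmono : inner ℝ (x j) ((rankOneSum x (σ \ {j}) ^ q) (x j)) ≤
      inner ℝ (x j) ((rankOneSum x σ ^ q) (x j)) := by
    by_cases hj : j ∈ σ
    · have := hpos.inner_pow_le_inner_pow_add_rankOne (x j) q
      rwa [← rankOneSum_insert x hdiff, Set.insert_sdiff_self_of_mem hj] at this
    · rw [Set.sdiff_singleton_eq_self hj]
  have h := hpos.inner_pow_add_rankOne_le (x j) q
  rw [← rankOneSum_insert x hdiff, Set.insert_sdiff_singleton] at h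
  linarith

lemma trace_pow_succ_rankOneSum (x : ι → E) (σ : Set ι) (q : ℕ) :
    LinearMap.trace ℝ E (rankOneSum x σ ^ (q + 1) : E →L[ℝ] E) =
      ∑ j, {σ : Set ι | j ∈ σ}.indicator
        (fun σ => inner ℝ (x j) ((rankOneSum x σ ^ q) (x j))) σ := by
  set T := rankOneSum x σ ^ q with hT
  have h : (rankOneSum x σ ^ (q + 1) : E →L[ℝ] E) =
      ∑ j, σ.indicator (fun j => rankOne ℝ (T (x j)) (x j)) j := by
    rw [pow_succ, ← hT, rankOneSum, Finset.mul_sum]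
    refine Finset.sum_congr rfl fun j _ => ?_
    by_cases hj : j ∈ σ
    · simp only [Set.indicator_of_mem hj]
      exact comp_rankOne _ _ _
    · simp [hj]
  rw [h, toLinearMap_sum, map_sum]
  refine Finset.sum_congr rfl fun j _ => ?_
  by_cases hj : j ∈ σ
  · rw [Set.indicator_of_mem hj, trace_rankOne]
    exact (Set.indicator_of_mem (s := {σ : Set ι | j ∈ σ}) hj
      (fun σ => inner ℝ (x j) ((rankOneSum x σ ^ q) (x j)))).symm
  · simp [hj]

/-- If `∑ x_j ⊗ x_j ≤ 1`, then compressing a positive operator by the family `x` does not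
increase its trace. -/
lemma sum_inner_le_trace {x : ι → E} (hx : ∀ v, ∑ j, inner ℝ v (x j) ^ 2 ≤ ‖v‖ ^ 2)
    {T : E →L[ℝ] E} (hT : T.IsPositive) :
    ∑ j, inner ℝ (x j) (T (x j)) ≤ LinearMap.trace ℝ E (T : E →ₗ[ℝ] E) := by
  obtain ⟨m, v, rfl⟩ := isPositive_iff_eq_sum_rankOne.1 hT
  rw [toLinearMap_sum, map_sum]
  simp only [sum_apply, rankOne_apply, inner_sum, inner_smul_right, trace_rankOne]
  rw [Finset.sum_comm]
  refine Finset.sum_le_sum fun i _ => ?_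
  rw [real_inner_self_eq_norm_sq]
  refine le_trans (le_of_eq ?_) (hx (v i))
  exact Finset.sum_congr rfl fun j _ => by rw [real_inner_comm (x j), sq]

lemma integral_trace_pow_succ_rankOneSum (x : ι → E) (δ : unitInterval) (q : ℕ) :
    ∫ σ, LinearMap.trace ℝ E (rankOneSum x σ ^ (q + 1) : E →L[ℝ] E)
        ∂(setBernoulli (Set.univ : Set ι) δ) =
      δ * ∑ j, ∫ σ, inner ℝ (x j) ((rankOneSum x (insert j σ) ^ q) (x j))
        ∂(setBernoulli (Set.univ : Set ι) δ) := by
  simp only [trace_pow_succ_rankOneSum]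
  rw [integral_finsetSum _ fun _ _ => .of_finite, Finset.mul_sum]
  exact Finset.sum_congr rfl fun j _ => integral_indicator_mem_setBernoulli δ j _

lemma integral_trace_pow_succ_rankOneSum_le {x : ι → E}
    (hx : ∀ v, ∑ j, inner ℝ v (x j) ^ 2 ≤ ‖v‖ ^ 2) {M : ℝ} (hM : ∀ j, ‖x j‖ ≤ M)
    (δ : unitInterval) (q : ℕ) :
    ∫ σ, LinearMap.trace ℝ E (rankOneSum x σ ^ (q + 1) : E →L[ℝ] E)
        ∂(setBernoulli (Set.univ : Set ι) δ) ≤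
      3 * δ * ∫ σ, LinearMap.trace ℝ E (rankOneSum x σ ^ q : E →L[ℝ] E)
        ∂(setBernoulli (Set.univ : Set ι) δ) +
      δ * (Fintype.card ι * (M ^ 2 * ((q + 1) * M ^ 2) ^ q)) := by
  set μ := setBernoulli (Set.univ : Set ι) δ
  have hδ : (0 : ℝ) ≤ δ := δ.2.1
  have hterm : ∀ j, ∫ σ, inner ℝ (x j) ((rankOneSum x (insert j σ) ^ q) (x j)) ∂μ ≤
      3 * ∫ σ, inner ℝ (x j) ((rankOneSum x σ ^ q) (x j)) ∂μ +
        M ^ 2 * ((q + 1) * M ^ 2) ^ q := fun j => by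
    have hsq : ‖x j‖ ^ 2 ≤ M ^ 2 := pow_le_pow_left₀ (norm_nonneg _) (hM j) 2
    calc _ ≤ ∫ σ, (3 * inner ℝ (x j) ((rankOneSum x σ ^ q) (x j)) +
          M ^ 2 * ((q + 1) * M ^ 2) ^ q) ∂μ := by
          refine integral_mono .of_finite .of_finite fun σ =>
            (inner_pow_rankOneSum_insert_le x σ j q).trans ?_
          gcongr
      _ = _ := by
        rw [integral_add .of_finite .of_finite, integral_const_mul]
        simp
  have hsum : ∑ j, ∫ σ, inner ℝ (x j) ((rankOneSum x σ ^ q) (x j)) ∂μ ≤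
      ∫ σ, LinearMap.trace ℝ E (rankOneSum x σ ^ q : E →L[ℝ] E) ∂μ := by
    rw [← integral_finsetSum _ fun _ _ => .of_finite]
    exact integral_mono .of_finite .of_finite fun σ =>
      sum_inner_le_trace hx ((isPositive_rankOneSum x σ).pow_isPositive q)
  rw [integral_trace_pow_succ_rankOneSum]
  have h1 := Finset.sum_le_sum fun j (_ : j ∈ Finset.univ) => hterm j
  rw [Finset.sum_add_distrib, ← Finset.mul_sum, Finset.sum_const, nsmul_eq_mul,
    Finset.card_univ] at h1
  calc _ ≤ δ * (3 * ∑ j, ∫ σ, inner ℝ (x j) ((rankOneSum x σ ^ q) (x j)) ∂μ +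
        Fintype.card ι * (M ^ 2 * ((q + 1) * M ^ 2) ^ q)) := mul_le_mul_of_nonneg_left h1 hδ
    _ ≤ δ * (3 * (∫ σ, LinearMap.trace ℝ E (rankOneSum x σ ^ q : E →L[ℝ] E) ∂μ) +
        Fintype.card ι * (M ^ 2 * ((q + 1) * M ^ 2) ^ q)) := by gcongr
    _ = _ := by ring

/-- Trace moments of a Bernoulli sum of rank-one operators. -/
theorem integral_trace_pow_rankOneSum_le {x : ι → E}
    (hx : ∀ v, ∑ j, inner ℝ v (x j) ^ 2 ≤ ‖v‖ ^ 2) {M : ℝ} (hM : ∀ j, ‖x j‖ ≤ M)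
    (δ : unitInterval) {p R : ℕ} (hp : p + 1 ≤ R) :
    ∫ σ, LinearMap.trace ℝ E (rankOneSum x σ ^ (p + 1) : E →L[ℝ] E)
        ∂(setBernoulli (Set.univ : Set ι) δ) ≤
      δ * Fintype.card ι * M ^ 2 * (3 * δ + R * M ^ 2) ^ p := by
  have hδ : (0 : ℝ) ≤ δ := δ.2.1
  induction p with
  | zero =>
    rw [integral_trace_pow_succ_rankOneSum]
    have : ∀ j, inner ℝ (x j) (x j) ≤ M ^ 2 := fun j => by
      rw [real_inner_self_eq_norm_sq]
      exact pow_le_pow_left₀ (norm_nonneg _) (hM j) 2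
    have h := Finset.sum_le_sum fun j (_ : j ∈ Finset.univ) => this j
    rw [Finset.sum_const, nsmul_eq_mul, Finset.card_univ] at h
    simpa [mul_assoc] using mul_le_mul_of_nonneg_left h hδ
  | succ p ih =>
    refine (integral_trace_pow_succ_rankOneSum_le hx hM δ (p + 1)).trans ?_
    have ih' := ih (by omega)
    -- The fixed `R` dominates every exponent met, so the base `3δ + R M²` is the same at each stage
    -- of the induction.
    have hR : (((p + 1 : ℕ) : ℝ) + 1) ≤ R := by exact_mod_cast hp
    have hpow : ((((p + 1 : ℕ) : ℝ) + 1) * M ^ 2) ^ (p + 1) ≤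
        (3 * δ + R * M ^ 2) ^ p * (R * M ^ 2) := by
      rw [pow_succ]
      have : (((p + 1 : ℕ) : ℝ) + 1) * M ^ 2 ≤ R * M ^ 2 := by gcongr
      gcongr
      linarith
    calc _ ≤ 3 * (δ : ℝ) * (δ * Fintype.card ι * M ^ 2 * (3 * δ + R * M ^ 2) ^ p) +
          (δ : ℝ) * (Fintype.card ι * (M ^ 2 * ((3 * δ + R * M ^ 2) ^ p * (R * M ^ 2)))) := by gcongr
      _ = _ := by ring

end RandomSums

/-! ### Operator norm against trace of powers -/

section Operators

open InnerProductSpace ContinuousLinearMap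

variable {E : Type*} [NormedAddCommGroup E] [InnerProductSpace ℝ E] [FiniteDimensional ℝ E]

lemma ContinuousLinearMap.IsPositive.inner_le_trace {T : E →L[ℝ] E} (hT : T.IsPositive) (v : E) :
    inner ℝ v (T v) ≤ ‖v‖ ^ 2 * LinearMap.trace ℝ E (T : E →ₗ[ℝ] E) := by
  obtain ⟨m, w, rfl⟩ := isPositive_iff_eq_sum_rankOne.1 hT
  rw [toLinearMap_sum, map_sum, Finset.mul_sum]
  simp only [sum_apply, rankOne_apply, inner_sum, inner_smul_right, trace_rankOne]
  refine Finset.sum_le_sum fun i _ => ?_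
  have := real_inner_mul_inner_self_le v (w i)
  rw [real_inner_self_eq_norm_sq v] at this
  rwa [real_inner_comm]

/-- The C*-identity settles exponents `2 ^ s`; splitting `a ^ 2 ^ s = a ^ s * a ^ (2 ^ s - s)` and
submultiplicativity give the rest. -/
lemma IsSelfAdjoint.norm_pow_eq {A : Type*} [NormedRing A] [StarRing A] [CStarRing A]
    {a : A} (ha : IsSelfAdjoint a) {s : ℕ} (hs : s ≠ 0) : ‖a ^ s‖ = ‖a‖ ^ s := by
  refine le_antisymm (norm_pow_le' a (Nat.pos_of_ne_zero hs)) ?_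
  rcases (norm_nonneg a).eq_or_lt with h | h
  · rw [← h, zero_pow hs]
    exact norm_nonneg _
  have hlt : s < 2 ^ s := Nat.lt_two_pow_self
  obtain ⟨k, hk⟩ := Nat.exists_eq_add_of_lt hlt
  refine le_of_mul_le_mul_right ?_ (pow_pos h (k + 1))
  calc ‖a‖ ^ s * ‖a‖ ^ (k + 1) = ‖a ^ 2 ^ s‖ := by
        rw [ha.norm_pow_two_pow, ← pow_add, hk, add_assoc]
    _ = ‖a ^ s * a ^ (k + 1)‖ := by rw [← pow_add, hk, add_assoc]
    _ ≤ ‖a ^ s‖ * ‖a ^ (k + 1)‖ := norm_mul_le _ _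
    _ ≤ ‖a ^ s‖ * ‖a‖ ^ (k + 1) :=
      mul_le_mul_of_nonneg_left (norm_pow_le' a k.succ_pos) (norm_nonneg _)

/-- The even exponent allows `⟨v, T^(2s) v⟩ = ‖T^s v‖²`. -/
lemma ContinuousLinearMap.IsPositive.norm_pow_le_trace {T : E →L[ℝ] E} (hT : T.IsPositive)
    {s : ℕ} (hs : s ≠ 0) :
    ‖T‖ ^ (2 * s) ≤ LinearMap.trace ℝ E (T ^ (2 * s) : E →L[ℝ] E) := by
  set t := LinearMap.trace ℝ E (T ^ (2 * s) : E →L[ℝ] E) with ht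
  have hpos := hT.pow_isPositive s
  have hv : ∀ v, ‖(T ^ s) v‖ ^ 2 ≤ t * ‖v‖ ^ 2 := fun v => by
    have h := (hT.pow_isPositive (2 * s)).inner_le_trace v
    have h2 : (T ^ (2 * s)) v = (T ^ s) ((T ^ s) v) := by rw [two_mul, pow_add]; rfl
    rwa [h2, ← hpos.inner_left_eq_inner_right, real_inner_self_eq_norm_sq, mul_comm] at h
  have ht0 : 0 ≤ t := (hT.pow_isPositive (2 * s)).toLinearMap.trace_nonneg
  have hnorm : ‖T ^ s‖ ≤ √t := opNorm_le_bound _ (Real.sqrt_nonneg _) fun v => by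
    refine le_of_pow_le_pow_left₀ two_ne_zero (by positivity) ?_
    rw [mul_pow, Real.sq_sqrt ht0]
    exact hv v
  rw [mul_comm, pow_mul, ← hT.isSelfAdjoint.norm_pow_eq hs]
  exact (Real.le_sqrt (norm_nonneg _) ht0).1 hnorm

end Operators

/-! ### From coordinate restrictions to rank-one sums -/

section CoordinateRestriction

open InnerProductSpace ContinuousLinearMap

variable {N : ℕ} (u : EuclideanSpace ℝ (Fin N) →L[ℝ] EuclideanSpace ℝ (Fin N))

/-- The columns `u e_j` of the operator `u`. -/
noncomputable def column (j : Fin N) : EuclideanSpace ℝ (Fin N) :=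
  u (EuclideanSpace.single j (1 : ℝ))

lemma apply_eq_sum_smul_column (v : EuclideanSpace ℝ (Fin N)) : u v = ∑ j, v j • column u j := by
  conv_lhs => rw [← (EuclideanSpace.basisFun (Fin N) ℝ).sum_repr v, map_sum]
  simp [column]

lemma sum_inner_column_sq_le (hu : ‖u‖ ≤ 1) (v : EuclideanSpace ℝ (Fin N)) :
    ∑ j, inner ℝ v (column u j) ^ 2 ≤ ‖v‖ ^ 2 := by
  have h := (EuclideanSpace.basisFun (Fin N) ℝ).sum_sq_inner_right (adjoint u v)
  have hle : ‖adjoint u v‖ ≤ ‖v‖ := by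
    refine ((adjoint u).le_opNorm v).trans ?_
    rw [LinearIsometryEquiv.norm_map]
    exact mul_le_of_le_one_left (norm_nonneg _) hu
  refine le_trans (le_of_eq ?_) (pow_le_pow_left₀ (norm_nonneg _) hle 2)
  rw [← h]
  refine Finset.sum_congr rfl fun j _ => ?_
  rw [adjoint_inner_right, real_inner_comm, EuclideanSpace.basisFun_apply]
  rfl

/-- For `w = u v` with `v ∈ ℝ^σ`, apply Cauchy–Schwarz to `‖w‖² = ∑_{j ∈ σ} v_j ⟨w, x_j⟩`, using
`∑_{j ∈ σ} ⟨w, x_j⟩² = ⟨w, X w⟩ ≤ ‖X‖ ‖w‖²`; then cancel `‖w‖²`. -/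
lemma norm_coordRestrict_sq_le (σ : Set (Fin N)) :
    ‖coordRestrict u σ‖ ^ 2 ≤ ‖rankOneSum (column u) σ‖ := by
  classical
  set X := rankOneSum (column u) σ with hX
  refine (Real.le_sqrt (norm_nonneg (coordRestrict u σ)) (norm_nonneg X)).1 ?_
  refine opNorm_le_bound _ (Real.sqrt_nonneg _) fun v => ?_
  refine le_of_pow_le_pow_left₀ two_ne_zero (by positivity) ?_
  rw [mul_pow, Real.sq_sqrt (norm_nonneg _)]
  change ‖u v‖ ^ 2 ≤ ‖X‖ * ‖(v : EuclideanSpace ℝ (Fin N))‖ ^ 2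
  set w := u v with hw
  have h1 : ‖w‖ ^ 2 = ∑ j, v.1 j * σ.indicator (fun j => inner ℝ w (column u j)) j := by
    rw [← real_inner_self_eq_norm_sq]
    nth_rewrite 2 [hw]
    rw [apply_eq_sum_smul_column, inner_sum]
    refine Finset.sum_congr rfl fun j _ => ?_
    rw [inner_smul_right]
    by_cases hj : j ∈ σ
    · rw [Set.indicator_of_mem hj]
    · rw [v.2 j hj, zero_mul, zero_mul]
  have h2 : ∑ j, σ.indicator (fun j => inner ℝ w (column u j)) j ^ 2 = inner ℝ w (X w) := by
    rw [hX, rankOneSum, sum_apply, inner_sum]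
    refine Finset.sum_congr rfl fun j _ => ?_
    by_cases hj : j ∈ σ
    · simp only [Set.indicator_of_mem hj, rankOne_apply, inner_smul_right]
      rw [real_inner_comm, sq]
    · simp [hj]
  have h3 : inner ℝ w (X w) ≤ ‖X‖ * ‖w‖ ^ 2 := by
    calc inner ℝ w (X w) ≤ ‖w‖ * ‖X w‖ := real_inner_le_norm _ _
      _ ≤ ‖w‖ * (‖X‖ * ‖w‖) := by gcongr; exact X.le_opNorm w
      _ = _ := by ring
  have h4 := Finset.sum_mul_sq_le_sq_mul_sq Finset.univ v.1.ofLp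
    (σ.indicator fun j => inner ℝ w (column u j))
  rw [← h1, h2, ← EuclideanSpace.real_norm_sq_eq] at h4
  rcases (norm_nonneg w).eq_or_lt with h0 | h0
  · rw [← h0, zero_pow two_ne_zero]; positivity
  · have h5 : ‖w‖ ^ 2 * ‖w‖ ^ 2 ≤ (‖X‖ * ‖v.1‖ ^ 2) * ‖w‖ ^ 2 := by
      have := mul_le_mul_of_nonneg_left h3 (sq_nonneg ‖v.1‖)
      nlinarith
    exact le_of_mul_le_mul_right h5 (by positivity)

/-- Moments of the norm of a random coordinate restriction. -/
lemma integral_norm_coordRestrict_pow_le (hu : ‖u‖ ≤ 1) {M : ℝ} (hM : ∀ j, ‖column u j‖ ≤ M)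
    (δ : unitInterval) {s : ℕ} (hs : s ≠ 0) :
    (∫ σ, ‖coordRestrict u σ‖ ∂(setBernoulli (Set.univ : Set (Fin N)) δ)) ^ (4 * s) ≤
      δ * N * (3 * δ + (2 * s : ℕ) * M ^ 2) ^ (2 * s) := by
  set μ := setBernoulli (Set.univ : Set (Fin N)) δ
  set D : ℝ := 3 * δ + (2 * s : ℕ) * M ^ 2 with hD
  have hδ : (0 : ℝ) ≤ δ := δ.2.1
  have hs1 : (1 : ℝ) ≤ (2 * s : ℕ) := by exact_mod_cast (by omega : 1 ≤ 2 * s)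
  -- This trades the spare factor `M ^ 2` of the moment bound for one more power of `D`.
  have hMD : M ^ 2 ≤ D := by nlinarith [sq_nonneg M]
  have hjensen : (∫ σ, ‖coordRestrict u σ‖ ∂μ) ^ (4 * s) ≤
      ∫ σ, ‖coordRestrict u σ‖ ^ (4 * s) ∂μ :=
    (convexOn_pow (4 * s)).map_integral_le (continuous_pow _).continuousOn isClosed_Ici
      (.of_forall fun σ => norm_nonneg (coordRestrict u σ)) .of_finite .of_finite
  have hpoint : ∀ σ, ‖coordRestrict u σ‖ ^ (4 * s) ≤
      LinearMap.trace ℝ (EuclideanSpace ℝ (Fin N)) (rankOneSum (column u) σ ^ (2 * s) :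
        EuclideanSpace ℝ (Fin N) →L[ℝ] EuclideanSpace ℝ (Fin N)) := fun σ => by
    calc ‖coordRestrict u σ‖ ^ (4 * s) = (‖coordRestrict u σ‖ ^ 2) ^ (2 * s) := by
          rw [← pow_mul]; congr 1; ring
      _ ≤ ‖rankOneSum (column u) σ‖ ^ (2 * s) :=
          pow_le_pow_left₀ (by positivity) (norm_coordRestrict_sq_le u σ) _
      _ ≤ _ := (isPositive_rankOneSum _ σ).norm_pow_le_trace hs
  obtain ⟨p, hp⟩ : ∃ p, 2 * s = p + 1 := ⟨2 * s - 1, by omega⟩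
  have hmom := integral_trace_pow_rankOneSum_le (sum_inner_column_sq_le u hu) hM δ hp.ge
  rw [← hp, ← hD, Fintype.card_fin] at hmom
  calc _ ≤ _ := hjensen
    _ ≤ _ := integral_mono .of_finite .of_finite hpoint
    _ ≤ δ * N * M ^ 2 * D ^ p := hmom
    _ ≤ δ * N * D * D ^ p := by
        have : 0 ≤ D := (sq_nonneg M).trans hMD
        gcongr
    _ = δ * N * D ^ (2 * s) := by rw [hp]; ring

end CoordinateRestriction

/-! ### Choice of the moment and conclusion -/

theorem mainTheorem1 :
    ∃ C : ℝ, 0 < C ∧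
      ∀ (N n : ℕ) (_hn : 1 < n) (_hnN : n ≤ N)
        (u : EuclideanSpace ℝ (Fin N) →L[ℝ] EuclideanSpace ℝ (Fin N)) (_hu : ‖u‖ = 1)
        (δ : unitInterval) (_hδ : (δ : ℝ) = (n : ℝ) / (N : ℝ)),
        Integrable (fun σ : Set (Fin N) => ‖coordRestrict u σ‖)
            (setBernoulli (Set.univ : Set (Fin N)) δ) ∧
          ∫ σ : Set (Fin N), ‖coordRestrict u σ‖ ∂(setBernoulli (Set.univ : Set (Fin N)) δ) ≤
            C * √(Real.log n) *
              (√((n : ℝ) / (N : ℝ)) +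
                √(Real.log n) * ⨆ j : Fin N, ‖u (EuclideanSpace.single j (1 : ℝ))‖) := by
  refine ⟨5, by norm_num, fun N n hn hnN u hu δ hδ => ⟨.of_finite, ?_⟩⟩
  set M : ℝ := ⨆ j : Fin N, ‖u (EuclideanSpace.single j (1 : ℝ))‖
  set L : ℝ := Real.log n
  set I : ℝ := ∫ σ : Set (Fin N), ‖coordRestrict u σ‖ ∂(setBernoulli (Set.univ : Set (Fin N)) δ)
  have hI : 0 ≤ I := integral_nonneg fun σ => norm_nonneg (coordRestrict u σ)
  have hM : ∀ j, ‖column u j‖ ≤ M := fun j =>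
    le_ciSup (f := fun j : Fin N => ‖u (EuclideanSpace.single j (1 : ℝ))‖)
      (Set.finite_range _).bddAbove j
  have hM0 : 0 ≤ M := Real.iSup_nonneg fun _ => norm_nonneg _
  have hn0 : (0 : ℝ) < n := by exact_mod_cast (by omega : 0 < n)
  have hN0 : (0 : ℝ) < N := by exact_mod_cast (by omega : 0 < N)
  -- The lower bound is used twice: `⌈L⌉ ≤ L + 1 ≤ 3L`, and `12 ≤ 25L` at the end.
  have hL : 1 / 2 ≤ L := by
    have : Real.log 2 ≤ L := Real.log_le_log (by norm_num) (by exact_mod_cast hn)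
    linarith [Real.log_two_gt_d9]
  set s : ℕ := ⌈L⌉₊ with hs
  have hs0 : s ≠ 0 := (Nat.ceil_pos.2 (by linarith)).ne'
  have hLs : L ≤ s := Nat.le_ceil L
  have hsL : (s : ℝ) ≤ 3 * L := by linarith [Nat.ceil_lt_add_one (show 0 ≤ L by linarith)]
  have hδ0 : (0 : ℝ) ≤ δ := δ.2.1
  rw [← hδ]
  have hmom := integral_norm_coordRestrict_pow_le u hu.le hM δ hs0
  set D : ℝ := 3 * δ + (2 * s : ℕ) * M ^ 2 with hD
  have hD0 : 0 ≤ D := by positivity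
  -- The prefactor `n` costs only a factor `2` after taking `2s`-th roots.
  have hn4 : (n : ℝ) ≤ 4 ^ s := by
    calc (n : ℝ) = Real.exp L := (Real.exp_log hn0).symm
      _ ≤ Real.exp (s * 1) := Real.exp_le_exp.2 (by simpa using hLs)
      _ = Real.exp 1 ^ s := Real.exp_nat_mul _ _
      _ ≤ 4 ^ s := pow_le_pow_left₀ (Real.exp_pos _).le (by linarith [Real.exp_one_lt_d9]) _
  have hI2 : I ^ 2 ≤ 2 * D := by
    refine le_of_pow_le_pow_left₀ (n := 2 * s) (by omega) (by positivity) ?_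
    calc (I ^ 2) ^ (2 * s) = I ^ (4 * s) := by rw [← pow_mul]; congr 1; ring
      _ ≤ δ * N * D ^ (2 * s) := hmom
      _ = n * D ^ (2 * s) := by rw [hδ, div_mul_cancel₀ _ hN0.ne']
      _ ≤ 4 ^ s * D ^ (2 * s) := by gcongr
      _ = (2 * D) ^ (2 * s) := by rw [mul_pow, pow_mul 2 2 s]; norm_num
  have hDL : D ≤ 3 * δ + 6 * L * M ^ 2 := by
    rw [hD]; push_cast
    nlinarith [sq_nonneg M]
  have hsqL : √L ^ 2 = L := Real.sq_sqrt (by linarith)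
  have hsqδ : √(δ : ℝ) ^ 2 = δ := Real.sq_sqrt hδ0
  have hcross : 0 ≤ √(δ : ℝ) * (√L * M) := by positivity
  have hsum : (δ : ℝ) + L * M ^ 2 ≤ (√(δ : ℝ) + √L * M) ^ 2 := by
    have h : (√(δ : ℝ) + √L * M) ^ 2 =
        √(δ : ℝ) ^ 2 + √L ^ 2 * M ^ 2 + 2 * (√(δ : ℝ) * (√L * M)) := by ring
    rw [h, hsqL, hsqδ]
    linarith
  refine le_of_pow_le_pow_left₀ two_ne_zero (by positivity) ?_
  calc I ^ 2 ≤ 12 * ((δ : ℝ) + L * M ^ 2) := by linarith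
    -- The preceding bound has no outer logarithm; the factor `L` is inserted only to match the
    -- stated form, and `25 = 5²` gives the constant.
    _ ≤ 25 * L * ((δ : ℝ) + L * M ^ 2) := by
        have : 0 ≤ (δ : ℝ) + L * M ^ 2 := by positivity
        gcongr
        linarith
    _ ≤ 25 * L * (√(δ : ℝ) + √L * M) ^ 2 := by gcongr
    _ = (5 * √L * (√(δ : ℝ) + √L * M)) ^ 2 := by rw [mul_pow, mul_pow, hsqL]; norm_num
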